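/- Let $q$ be a prime power, let $\operatorname{Tr}$ and $\operatorname{N}$ be the trace and the norm from $\mathbb{F}_{q^3}$ to $\mathbb{F}_q$, and let $\theta\in\mathbb{F}_{q^3}$ be such that $\mathbb{F}_{q^3}=\mathbb{F}_q(\theta)$ (for instance, a generator of the multiplicative group $\mathbb{F}_{q^3}^*$). Let $x_1,\dots,x_{q^3}$ be the elements of $\mathbb{F}_{q^3}$ in any order, let $e_8=(0,0,0,0,0,0,0,1)^\top$, and for $x\in\mathbb{F}_{q^3}$ put \[ g(x)=\bigl(1,\operatorname{Tr}(x),\operatorname{Tr}(\theta x),\operatorname{Tr}(\theta^2x),\operatorname{Tr}(x^{q+q^2}),\operatorname{Tr}(\theta x^{q+q^2}),\operatorname{Tr}(\theta^2x^{q+q^2}),\operatorname{N}(x)\bigr)^\top . \] (The columns $g(x_1),\dots,g(x_{q^3}),e_8$ are coordinate vectors of the $q^3+1$ points of $O=\{\langle(1,x,x^{q+q^2},\operatorname{N}(x))\rangle : x\in\mathbb{F}_{q^3}\}\cup\{\langle(0,0,0,1)\rangle\}$ in the projective space of the $8$-dimensional $\mathbb{F}_q$-vector space $\mathbb{F}_q\times\mathbb{F}_{q^3}\times\mathbb{F}_{q^3}\times\mathbb{F}_q$.)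 Let $C_O\subseteq\mathbb{F}_q^{q^3+1}$ be the $\mathbb{F}_q$-linear code generated by the rows of the matrix \[ G_O=\begin{bmatrix} g(x_1)&g(x_2)&\cdots&g(x_{q^3})&e_8\end{bmatrix}. \] Then $C_O$ is a $[q^3+1,8,q^3-q^2-q]_q$ code, that is, $\dim_{\mathbb{F}_q}C_O=8$ and every nonzero codeword has Hamming weight at least $q^3-q^2-q$. The weight distribution of $C_O$ is as follows: \[ \begin{array}{cc} \text{weight} & \text{number of codewords}\\ \hline 0 & 1\\ q(q^2-q-1) & \tfrac12 q^3(q^3+1)(q-1)^2\\ q^2(q-1) & q(q^6-1)\\ q(q^2-q+1) & \tfrac12 q^3(q^3-1)(q^2-1)\\ q^3 & (q^3+1)(q-1) \end{array} \] and no codeword has any other weight. -/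

import Mathlib

/-- The column `g(x) = (1, Tr x, Tr (θx), Tr (θ²x), Tr x^{q+q²}, Tr (θx^{q+q²}), Tr (θ²x^{q+q²}), N x)`,
where `Tr` and `N` are the trace and the norm from `K` to `F`. -/
noncomputable def ovoidColumn (F : Type*) {K : Type*} [Field F] [Field K] [Algebra F K]
    (q : ℕ) (θ x : K) : Fin 8 → F :=
  ![1,
    Algebra.trace F K x,
    Algebra.trace F K (θ * x),
    Algebra.trace F K (θ ^ 2 * x),
    Algebra.trace F K (x ^ (q + q ^ 2)),
    Algebra.trace F K (θ * x ^ (q + q ^ 2)),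
    Algebra.trace F K (θ ^ 2 * x ^ (q + q ^ 2)),
    Algebra.norm F x]

/-- The matrix with columns `g(x_1), …, g(x_{q³}), e_8`, for an enumeration `x` of `K`. -/
noncomputable def ovoidMatrix (F : Type*) {K : Type*} [Field F] [Field K] [Algebra F K]
    (q : ℕ) (θ : K) (x : Fin (q ^ 3) ≃ K) : Matrix (Fin 8) (Fin (q ^ 3 + 1)) F :=
  Matrix.of fun i j =>
    Fin.snoc (α := fun _ => Fin 8 → F) (fun k => ovoidColumn F q θ (x k)) (Pi.single 7 1) j i

/-- The linear code generated by a matrix: the span of its rows. -/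
def codeGeneratedBy {F : Type*} [Field F] {k n : ℕ} (G : Matrix (Fin k) (Fin n) F) :
    Submodule F (Fin n → F) :=
  Submodule.span F (Set.range fun i => G i)

/-- The code `C_O`. -/
noncomputable def ovoidCode (F : Type*) {K : Type*} [Field F] [Field K] [Algebra F K]
    (q : ℕ) (θ : K) (x : Fin (q ^ 3) ≃ K) : Submodule F (Fin (q ^ 3 + 1) → F) :=
  codeGeneratedBy (ovoidMatrix F q θ x)

/-- `C ⊆ F^n` is an `[n, k, d]` code: it has dimension `k`, and every nonzero codeword has Hamming
weight at least `d`. -/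
def HasCodeParameters {F : Type*} [Field F] [DecidableEq F] {n : ℕ}
    (C : Submodule F (Fin n → F)) (k d : ℕ) : Prop :=
  Module.finrank F C = k ∧ ∀ c ∈ C, c ≠ 0 → d ≤ hammingNorm c

/-- The number `A_i` of codewords of Hamming weight `i`. -/
noncomputable def weightCount {F : Type*} [Field F] [DecidableEq F] {n : ℕ}
    (C : Submodule F (Fin n → F)) (i : ℕ) : ℕ :=
  Set.ncard {c : Fin n → F | c ∈ C ∧ hammingNorm c = i}

/-!
Up to coordinates, a codeword is the list of values of a linear form
`f(x) = a + Tr (β x) + Tr (γ x^(q+q²)) + d N x` at the points of `K ∪ {∞}`, with `f(∞) = d`; its weight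
is `q³ + 1` minus the number of zeros of `f`. So the distribution of the number of zeros over all
`(a, β, γ, d)` in `F × K × K × F` is needed.

The translations `x ↦ x + t` and the inversion `x ↦ x⁻¹` of `K ∪ {∞}` carry linear forms to linear
forms, up to nonzero factors, and generate a 2-transitive group (`exists_preservesSections`). Forms
with at least two zeros can thus be moved to forms that vanish at `∞` and `0`, that is, to
`f(x) = Tr (β x) + Tr (γ x^(q+q²))`. Counting triples of a form with `z` zeros and two of these zeros
gives the number of forms with `z ≥ 2` zeros from the corresponding number for pairs `(β, γ)`
(`sectionCount_mul`).

For a pair with `β, γ ≠ 0`, the linear form `L = Tr (β x)` and the quadratic form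
`Q = Tr (γ x^(q+q²))` define a line and a conic in the projective plane of `K` over `F`. By scaling,
`L + Q` has as many nonzero zeros as each `L + c Q`, and summing over `c ≠ 0` shows that this number is
`q² - q - 1 + q m`, where `m` is the number of points common to the line and the conic
(`exists_pencilCount_eq`). The conic has no three collinear points, because
`Tr γ = Tr (γ u) = Tr (γ u^(q+q²)) = 0` with `u` outside `F` forces `γ = 0`
(`frobenius_eq_of_trace_eq_zero`), so `m ≤ 2`. Three values are possible, and their multiplicities
follow from the first moments: any two distinct nonzero `x`, `y` impose independent conditions on
`(β, γ)` (`pencilEval_prod_surjective`, `card_filter_pencilCount_eq`).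

Finally, the number `q⁸` of all forms and the number `(q³ + 1) q⁷` of incidences of forms with points
fix how many forms have one zero, and show that none is without zeros (`sectionCount_eq`). Only the
zero form vanishes everywhere, which gives the dimension `8`.
-/

/-! ### Conjugates, trace and norm in a cubic extension -/

section Frobenius

variable {F K : Type*} [Field F] [Fintype F] [Field K] [Algebra F K]

/-- The product `x^(q+q²)` of the two other conjugates of `x`, written through the Frobenius
automorphism so that it is visibly compatible with sums and products. -/
noncomputable def coNorm (F : Type*) {K : Type*} [Field F] [Fintype F] [Field K] [Algebra F K]
    (x : K) : K :=
  FiniteField.frobeniusAlgHom F K x *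
    FiniteField.frobeniusAlgHom F K (FiniteField.frobeniusAlgHom F K x)

local notation "σ" => FiniteField.frobeniusAlgHom F K
local notation "Tr" => Algebra.trace F K
local notation "Nm" => Algebra.norm F (S := K)

theorem coNorm_eq_pow (x : K) : coNorm F x = x ^ (Fintype.card F + Fintype.card F ^ 2) := by
  simp only [coNorm, FiniteField.frobeniusAlgHom_apply]
  ring

theorem coNorm_zero : coNorm F (0 : K) = 0 := by simp [coNorm]

theorem coNorm_one : coNorm F (1 : K) = 1 := by simp [coNorm]

theorem coNorm_mul (x y : K) : coNorm F (x * y) = coNorm F x * coNorm F y := by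
  simp only [coNorm, map_mul]
  ring

theorem coNorm_smul (c : F) (x : K) : coNorm F (c • x) = c ^ 2 • coNorm F x := by
  simp only [coNorm, map_smul, smul_mul_smul_comm, pow_two]

theorem coNorm_ne_zero {x : K} (hx : x ≠ 0) : coNorm F x ≠ 0 := by
  simp [coNorm, hx]

variable (hK : Module.finrank F K = 3)
include hK

theorem frobenius_frobenius_frobenius (x : K) : σ (σ (σ x)) = x := by
  have : FiniteDimensional F K := Module.finite_of_finrank_pos (by omega)
  have : Finite K := Module.finite_of_finite F
  have h := pow_orderOf_eq_one (FiniteField.frobeniusAlgHom F K)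
  rw [FiniteField.orderOf_frobeniusAlgHom, hK] at h
  exact DFunLike.congr_fun h x

theorem algebraMap_trace_eq_conjugates (x : K) :
    algebraMap F K (Tr x) = x + σ x + σ (σ x) := by
  have : FiniteDimensional F K := Module.finite_of_finrank_pos (by omega)
  have : Finite K := Module.finite_of_finite F
  rw [FiniteField.algebraMap_trace_eq_sum_pow, hK]
  simp only [Finset.sum_range_succ, Finset.sum_range_zero, FiniteField.frobeniusAlgHom_apply,
    Nat.card_eq_fintype_card]
  ring

theorem algebraMap_norm_eq_mul_coNorm (x : K) :
    algebraMap F K (Nm x) = x * coNorm F x := by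
  have : FiniteDimensional F K := Module.finite_of_finrank_pos (by omega)
  have : Finite K := Module.finite_of_finite F
  rw [FiniteField.algebraMap_norm_eq_prod_pow, hK, coNorm_eq_pow]
  simp only [Finset.prod_range_succ, Finset.prod_range_zero, Nat.card_eq_fintype_card]
  ring

theorem mem_range_algebraMap_of_frobenius_eq {x : K} (hx : σ x = x) :
    ∃ c : F, algebraMap F K c = x := by
  have : FiniteDimensional F K := Module.finite_of_finrank_pos (by omega)
  have : Finite K := Module.finite_of_finite F
  refine (IsGalois.mem_range_algebraMap_iff_fixed x).2 fun τ ↦ ?_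
  obtain ⟨n, rfl⟩ := (FiniteField.bijective_frobeniusAlgEquivOfAlgebraic_pow F K).2 τ
  have hx' : FiniteField.frobeniusAlgEquivOfAlgebraic F K x = x := hx
  simp only [AlgEquiv.coe_pow]
  exact Function.iterate_fixed hx' _

theorem trace_mul_coNorm_add (γ x t : K) :
    Tr (γ * coNorm F (x + t)) = Tr (γ * coNorm F x) +
      Tr ((σ (σ γ) * σ t + σ γ * σ (σ t)) * x) + Tr (γ * coNorm F t) := by
  apply (algebraMap F K).injective
  simp only [map_add, map_mul, algebraMap_trace_eq_conjugates hK, coNorm,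
    frobenius_frobenius_frobenius hK]
  ring

theorem norm_add (x t : K) :
    Nm (x + t) = Nm x + Tr (t * coNorm F x) + Tr (coNorm F t * x) + Nm t := by
  apply (algebraMap F K).injective
  simp only [map_add, map_mul, algebraMap_trace_eq_conjugates hK,
    algebraMap_norm_eq_mul_coNorm hK, coNorm, frobenius_frobenius_frobenius hK]
  ring

theorem norm_mul_trace_inv (γ : K) {x : K} (hx : x ≠ 0) :
    Nm x * Tr (γ * x⁻¹) = Tr (γ * coNorm F x) := by
  rw [← smul_eq_mul, ← map_smul, Algebra.smul_def, algebraMap_norm_eq_mul_coNorm hK]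
  congr 1
  field_simp

theorem norm_mul_trace_coNorm_inv (β : K) {x : K} (hx : x ≠ 0) :
    Nm x * Tr (β * coNorm F x⁻¹) = Tr (β * x) := by
  rw [← smul_eq_mul, ← map_smul, Algebra.smul_def, algebraMap_norm_eq_mul_coNorm hK]
  have h : coNorm F x * coNorm F x⁻¹ = 1 := by rw [← coNorm_mul, mul_inv_cancel₀ hx, coNorm_one]
  congr 1
  linear_combination x * β * h

/-- The conic `Tr (γ x^(q+q²)) = 0` has no three collinear points: normalised so that two of the
points are `1` and `u`, the three conditions say that `γ` is orthogonal to `1`, `u` and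
`u² = u Tr u - Tr (u^(q+q²)) + u^(q+q²)`. -/
theorem frobenius_eq_of_trace_eq_zero {γ u : K} (hγ : γ ≠ 0) (h1 : Tr γ = 0)
    (hu : Tr (γ * u) = 0) (hu2 : Tr (γ * coNorm F u) = 0) : σ u = u := by
  have e1 := congrArg (algebraMap F K) h1
  have e2 := congrArg (algebraMap F K) hu
  have e3 := congrArg (algebraMap F K) hu2
  simp only [map_mul, map_zero, algebraMap_trace_eq_conjugates hK, coNorm,
    frobenius_frobenius_frobenius hK] at e1 e2 e3
  by_contra hne
  have hne2 : u - σ (σ u) ≠ 0 := fun h ↦ hne <| by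
    rw [sub_eq_zero] at h
    conv_rhs => rw [← frobenius_frobenius_frobenius hK u, ← h]
  -- The combination with coefficients of `(X - σ u) (X - σ² u)` isolates `γ`.
  have hprod : γ * ((u - σ u) * (u - σ (σ u))) = 0 := by
    linear_combination e3 + u * e2 - (u * σ u + u * σ (σ u)) * e1
  rcases mul_eq_zero.1 hprod with h | h
  · exact hγ h
  · rcases mul_eq_zero.1 h with h | h
    · exact hne (sub_eq_zero.1 h).symm
    · exact hne2 h

end Frobenius

/-- A surjective linear map between finite vector spaces has `qⁿ` zeros, where `n` is the difference
of the dimensions. -/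
theorem card_filter_eq_zero_of_surjective {F V W : Type*} [Field F] [Fintype F]
    [AddCommGroup V] [Module F V] [Fintype V] [AddCommGroup W] [Module F W]
    [DecidableEq W] {ℓ : V →ₗ[F] W} (hℓ : Function.Surjective ℓ) {n : ℕ}
    (hn : n + Module.finrank F W = Module.finrank F V) :
    (Finset.univ.filter fun v ↦ ℓ v = 0).card = Fintype.card F ^ n := by
  classical
  have h := LinearMap.finrank_range_add_finrank_ker ℓ
  rw [LinearMap.range_eq_top.2 hℓ, finrank_top] at h
  have hc := Module.card_eq_pow_finrank (K := F) (V := LinearMap.ker ℓ)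
  rw [show Module.finrank F (LinearMap.ker ℓ) = n by omega] at hc
  rw [← hc, Fintype.card_subtype]
  simp

/-! ### Linear forms on the ovoid and the 2-transitive group -/

section Transitivity

variable {F K : Type*} [Field F] [Fintype F] [Field K] [Algebra F K]

local notation "σ" => FiniteField.frobeniusAlgHom F K
local notation "Tr" => Algebra.trace F K
local notation "Nm" => Algebra.norm F (S := K)

/-- The linear forms on `F × K × K × F`, restricted to the point set `O`: the parameters
`(a, β, γ, d)` give `a + Tr (β x) + Tr (γ x^(q+q²)) + d N x` at the affine point `some x` and `d` at
the point at infinity `none`. -/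
noncomputable def ovoidForm (F K : Type*) [Field F] [Fintype F] [Field K] [Algebra F K] :
    F × K × K × F →ₗ[F] Option K → F where
  toFun f P := P.elim f.2.2.2 fun x ↦ f.1 + Algebra.trace F K (f.2.1 * x) +
    Algebra.trace F K (f.2.2.1 * coNorm F x) + f.2.2.2 * Algebra.norm F x
  map_add' f g := by
    funext P
    cases P with
    | none => rfl
    | some x =>
      simp only [Option.elim_some, Prod.fst_add, Prod.snd_add, add_mul, map_add, Pi.add_apply]
      ring
  map_smul' c f := by
    funext P
    cases P with
    | none => rfl
    | some x =>
      simp only [Option.elim_some, Prod.smul_fst, Prod.smul_snd, smul_mul_assoc, map_smul,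
        RingHom.id_apply, Pi.smul_apply, smul_eq_mul]
      ring

theorem ovoidForm_none (f : F × K × K × F) : ovoidForm F K f none = f.2.2.2 := rfl

theorem ovoidForm_some (f : F × K × K × F) (x : K) : ovoidForm F K f (some x) =
    f.1 + Tr (f.2.1 * x) + Tr (f.2.2.1 * coNorm F x) + f.2.2.2 * Nm x := rfl

/-- A permutation of the points of `O` that permutes the hyperplane sections of `O`. The map on
forms need only be injective: on the finite set of forms it is then a bijection. -/
def PreservesSections (F : Type*) {K : Type*} [Field F] [Fintype F] [Field K] [Algebra F K]
    (π : Equiv.Perm (Option K)) : Prop :=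
  ∃ φ : F × K × K × F → F × K × K × F, Function.Injective φ ∧
    ∀ f P, ovoidForm F K (φ f) P = 0 ↔ ovoidForm F K f (π P) = 0

theorem PreservesSections.mul {π ρ : Equiv.Perm (Option K)} (hπ : PreservesSections F π)
    (hρ : PreservesSections F ρ) : PreservesSections F (π * ρ) := by
  obtain ⟨φ, hφ, h⟩ := hπ
  obtain ⟨ψ, hψ, h'⟩ := hρ
  exact ⟨ψ ∘ φ, hψ.comp hφ, fun f P ↦ (h' _ _).trans (h _ _)⟩

/-- The inversion `x ↦ x⁻¹` of the projective line, exchanging `0` and the point at infinity. -/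
def projectiveInversion (K : Type*) [Field K] [DecidableEq K] : Equiv.Perm (Option K) where
  toFun P := P.elim (some 0) fun x ↦ if x = 0 then none else some x⁻¹
  invFun P := P.elim (some 0) fun x ↦ if x = 0 then none else some x⁻¹
  left_inv P := by
    cases P with
    | none => simp
    | some x => by_cases hx : x = 0 <;> simp [hx]
  right_inv P := by
    cases P with
    | none => simp
    | some x => by_cases hx : x = 0 <;> simp [hx]

theorem projectiveInversion_none [DecidableEq K] : projectiveInversion K none = some 0 := rfl

theorem projectiveInversion_zero [DecidableEq K] : projectiveInversion K (some 0) = none := by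
  simp [projectiveInversion]

theorem projectiveInversion_some [DecidableEq K] {x : K} (hx : x ≠ 0) :
    projectiveInversion K (some x) = some x⁻¹ := by
  simp [projectiveInversion, hx]

variable (hK : Module.finrank F K = 3)
include hK

theorem preservesSections_translation (t : K) :
    PreservesSections F (Equiv.optionCongr (Equiv.addRight t)) := by
  refine ⟨fun f ↦ (ovoidForm F K f (some t),
    f.2.1 + (σ (σ f.2.2.1) * σ t + σ f.2.2.1 * σ (σ t)) + f.2.2.2 • coNorm F t,
    f.2.2.1 + f.2.2.2 • t, f.2.2.2), ?_, ?_⟩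
  · rintro ⟨a, β, γ, d⟩ ⟨a', β', γ', d'⟩ h
    simp only [Prod.mk.injEq, ovoidForm_some] at h
    obtain ⟨ha, hβ, hγ, rfl⟩ := h
    obtain rfl := add_right_cancel hγ
    obtain rfl := add_right_cancel (add_right_cancel hβ)
    simp only [add_left_inj] at ha
    rw [ha]
  · rintro ⟨a, β, γ, d⟩ P
    cases P with
    | none => rfl
    | some x =>
      simp only [Equiv.optionCongr_apply, Option.map_some, Equiv.coe_addRight, ovoidForm_some]
      rw [norm_add hK, trace_mul_coNorm_add hK]
      simp only [mul_add, add_mul, smul_mul_assoc, map_add, map_smul, smul_eq_mul]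
      refine Eq.congr_left ?_
      ring

theorem preservesSections_inversion [DecidableEq K] :
    PreservesSections F (projectiveInversion K) := by
  refine ⟨fun f ↦ (f.2.2.2, f.2.2.1, f.2.1, f.1), ?_, ?_⟩
  · rintro ⟨a, β, γ, d⟩ ⟨a', β', γ', d'⟩ h
    simp only [Prod.mk.injEq] at h ⊢
    tauto
  · rintro ⟨a, β, γ, d⟩ P
    cases P with
    | none =>
      rw [projectiveInversion_none, ovoidForm_none, ovoidForm_some]
      have : FiniteDimensional F K := Module.finite_of_finrank_pos (by omega)
      simp [coNorm_zero]
    | some x =>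
      by_cases hx : x = 0
      · subst hx
        rw [projectiveInversion_zero, ovoidForm_none, ovoidForm_some]
        have : FiniteDimensional F K := Module.finite_of_finrank_pos (by omega)
        simp [coNorm_zero]
      · rw [projectiveInversion_some hx, ovoidForm_some, ovoidForm_some]
        have : FiniteDimensional F K := Module.finite_of_finrank_pos (by omega)
        have hN : Nm x ≠ 0 := Algebra.norm_ne_zero_iff.2 hx
        have hinv : Nm x * Nm x⁻¹ = 1 := by rw [← map_mul, mul_inv_cancel₀ hx, map_one]
        refine Iff.trans ?_ (mul_eq_zero_iff_left hN)
        refine Eq.congr_left ?_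
        dsimp only
        rw [← norm_mul_trace_inv hK β hx, ← norm_mul_trace_coNorm_inv hK γ hx]
        linear_combination (-d) * hinv

/-- The group preserving the hyperplane sections of `O` is 2-transitive on `O`. -/
theorem exists_preservesSections {P Q : Option K} (hPQ : P ≠ Q) :
    ∃ π, PreservesSections F π ∧ π none = P ∧ π (some 0) = Q := by
  classical
  cases P with
  | none =>
    cases Q with
    | none => exact absurd rfl hPQ
    | some b => exact ⟨_, preservesSections_translation hK b, rfl, by simp⟩
  | some a =>
    -- Send `none` to `0` by the inversion, then to `a`; the second point is adjusted beforehand by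
    -- a translation, which fixes `none`.
    let ρ : Equiv.Perm (Option K) := Equiv.optionCongr (Equiv.addRight a) * projectiveInversion K
    have hρ : PreservesSections F ρ :=
      (preservesSections_translation hK a).mul (preservesSections_inversion hK)
    have hρn : ρ none = some a := by simp [ρ, projectiveInversion_none]
    cases hc : ρ.symm Q with
    | none => exact absurd (by rw [← hρn, ← hc, Equiv.apply_symm_apply]) hPQ
    | some c =>
      refine ⟨ρ * Equiv.optionCongr (Equiv.addRight c),
        hρ.mul (preservesSections_translation hK c), ?_, ?_⟩
      · simp [hρn]
      · simp [← hc]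

end Transitivity

/-! ### Sections through zero and infinity -/

section Pencil

variable {F K : Type*} [Field F] [Fintype F] [Field K] [Algebra F K]

local notation "σ" => FiniteField.frobeniusAlgHom F K
local notation "Tr" => Algebra.trace F K

/-- The sections of `O` by hyperplanes through the point at infinity and the point `0` are given by
pairs `(β, γ)`; this is the number of further points `x ≠ 0` on such a section. -/
noncomputable def pencilCount [Fintype K] [DecidableEq F] [DecidableEq K] (p : K × K) : ℕ :=
  ((Finset.univ.erase (0 : K)).filter
    fun x ↦ Tr (p.1 * x) + Tr (p.2 * coNorm F x) = 0).card

variable (hK : Module.finrank F K = 3)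
include hK

theorem eq_zero_of_forall_trace_mul_eq_zero {β : K} (h : ∀ x, Tr (β * x) = 0) : β = 0 := by
  have : FiniteDimensional F K := Module.finite_of_finrank_pos (by omega)
  exact (traceForm_nondegenerate F K).1 β h

theorem card_eq_card_pow_three [Fintype K] : Fintype.card K = Fintype.card F ^ 3 := by
  rw [Module.card_eq_pow_finrank (K := F), hK]

theorem card_erase_zero [Fintype K] [DecidableEq K] :
    (Finset.univ.erase (0 : K)).card + 1 = Fintype.card F ^ 3 := by
  rw [Finset.card_erase_add_one (Finset.mem_univ _), Finset.card_univ, card_eq_card_pow_three hK]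

theorem card_trace_mul_eq_zero [Fintype K] [DecidableEq F] {β : K} (hβ : β ≠ 0) :
    (Finset.univ.filter fun x : K ↦ Tr (β * x) = 0).card = Fintype.card F ^ 2 := by
  have hs : Function.Surjective (Algebra.traceForm F K β) := by
    refine LinearMap.surjective fun h ↦ hβ ?_
    exact eq_zero_of_forall_trace_mul_eq_zero hK fun x ↦ DFunLike.congr_fun h x
  exact card_filter_eq_zero_of_surjective hs (n := 2) (by rw [hK, Module.finrank_self])

theorem card_ne_zero_trace_mul_eq_zero [Fintype K] [DecidableEq F] [DecidableEq K] {β : K}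
    (hβ : β ≠ 0) : ((Finset.univ.erase (0 : K)).filter fun x ↦ Tr (β * x) = 0).card + 1 =
      Fintype.card F ^ 2 := by
  rw [← card_trace_mul_eq_zero hK hβ, Finset.filter_erase]
  exact Finset.card_erase_add_one (by simp)

theorem trace_mul_coNorm_eq_zero_iff (γ : K) {x : K} (hx : x ≠ 0) :
    Tr (γ * coNorm F x) = 0 ↔ Tr (γ * x⁻¹) = 0 := by
  have : FiniteDimensional F K := Module.finite_of_finrank_pos (by omega)
  rw [← norm_mul_trace_inv hK γ hx]
  exact mul_eq_zero_iff_left (Algebra.norm_ne_zero_iff.2 hx)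

theorem card_ne_zero_trace_mul_coNorm_eq_zero [Fintype K] [DecidableEq F] [DecidableEq K] {γ : K}
    (hγ : γ ≠ 0) : ((Finset.univ.erase (0 : K)).filter fun x ↦ Tr (γ * coNorm F x) = 0).card + 1 =
      Fintype.card F ^ 2 := by
  rw [← card_ne_zero_trace_mul_eq_zero hK hγ]
  congr 1
  refine Finset.card_nbij' (·⁻¹) (·⁻¹) ?_ ?_ ?_ ?_
  · intro x hx
    simp only [Finset.coe_filter, Finset.mem_erase, Finset.mem_univ, and_true,
      Set.mem_ofPred_eq] at hx ⊢
    exact ⟨inv_ne_zero hx.1, (trace_mul_coNorm_eq_zero_iff hK γ hx.1).1 hx.2⟩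
  · intro x hx
    simp only [Finset.coe_filter, Finset.mem_erase, Finset.mem_univ, and_true,
      Set.mem_ofPred_eq] at hx ⊢
    refine ⟨inv_ne_zero hx.1, (trace_mul_coNorm_eq_zero_iff hK γ (inv_ne_zero hx.1)).2 ?_⟩
    rw [inv_inv]
    exact hx.2
  · intro x _
    exact inv_inv x
  · intro x _
    exact inv_inv x

theorem trace_mul_frobenius_add {γ : K} (h : Tr γ = 0) (u : K) :
    Tr (γ * (σ u + σ (σ u))) = -Tr (γ * u) := by
  have e : γ * (σ u + σ (σ u)) = Tr u • γ - γ * u := by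
    rw [Algebra.smul_def, algebraMap_trace_eq_conjugates hK]
    ring
  rw [e, map_sub, map_smul, h, smul_zero, zero_sub]

/-- On the conic `Tr (γ x^(q+q²)) = 0`, the polar form does not vanish at two distinct points. -/
theorem exists_smul_eq_of_polar_eq_zero {γ x y : K} (hγ : γ ≠ 0) (hx : x ≠ 0)
    (h1 : Tr (γ * coNorm F x) = 0) (h2 : Tr (γ * coNorm F y) = 0)
    (h3 : Tr (γ * (σ x * σ (σ y) + σ y * σ (σ x))) = 0) : ∃ c : F, y = c • x := by
  obtain ⟨u, rfl⟩ : ∃ u, y = u * x := ⟨y / x, by field_simp⟩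
  have h3' : Tr (γ * coNorm F x * u) = 0 := by
    rw [← neg_eq_zero, ← trace_mul_frobenius_add hK h1, ← h3]
    congr 1
    simp only [map_mul, coNorm]
    ring
  have h2' : Tr (γ * coNorm F x * coNorm F u) = 0 := by
    rw [← h2, coNorm_mul]
    congr 1
    ring
  obtain ⟨c, rfl⟩ := mem_range_algebraMap_of_frobenius_eq hK <|
    frobenius_eq_of_trace_eq_zero hK (mul_ne_zero hγ (coNorm_ne_zero hx)) h1 h3' h2'
  exact ⟨c, (Algebra.smul_def _ _).symm⟩

omit hK in
theorem trace_mul_coNorm_smul_add_smul (γ x y : K) (c d : F) :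
    Tr (γ * coNorm F (c • x + d • y)) = c ^ 2 * Tr (γ * coNorm F x) +
      c * d * Tr (γ * (σ x * σ (σ y) + σ y * σ (σ x))) + d ^ 2 * Tr (γ * coNorm F y) := by
  have hs : ∀ (a : F) (z : K), a * Tr z = Tr (a • z) := fun a z ↦ (map_smul _ a z).symm
  rw [hs, hs, hs, ← map_add, ← map_add]
  congr 1
  simp only [coNorm, map_add, Algebra.smul_def, map_mul, map_pow, AlgHom.commutes]
  ring

/-- A line meets a conic in at most two points; nonzero vectors are counted instead of points, hence
the factor `q - 1`. -/
theorem card_line_inter_conic [Fintype K] [DecidableEq F] [DecidableEq K] {β γ : K}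
    (hβ : β ≠ 0) (hγ : γ ≠ 0) :
    ∃ m ≤ 2, ((Finset.univ.erase (0 : K)).filter
      fun x ↦ Tr (β * x) = 0 ∧ Tr (γ * coNorm F x) = 0).card = m * (Fintype.card F - 1) := by
  set M := (Finset.univ.erase (0 : K)).filter
      fun x ↦ Tr (β * x) = 0 ∧ Tr (γ * coNorm F x) = 0 with hM
  have memM : ∀ x, x ∈ M ↔ x ≠ 0 ∧ Tr (β * x) = 0 ∧ Tr (γ * coNorm F x) = 0 := by simp [hM]
  let orb : K → Finset K := fun x ↦ (Finset.univ.erase (0 : F)).image (· • x)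
  have mem_orb : ∀ x y, y ∈ orb x ↔ ∃ c : F, c ≠ 0 ∧ c • x = y := by simp [orb]
  have orb_card : ∀ x ≠ 0, (orb x).card = Fintype.card F - 1 := fun x hx ↦ by
    rw [Finset.card_image_of_injective _ (smul_left_injective F hx),
      Finset.card_erase_of_mem (Finset.mem_univ _), Finset.card_univ]
  have orb_sub : ∀ x ∈ M, orb x ⊆ M := fun x hx y hy ↦ by
    obtain ⟨c, hc, rfl⟩ := (mem_orb x y).1 hy
    obtain ⟨h0, h1, h2⟩ := (memM x).1 hx
    refine (memM _).2 ⟨smul_ne_zero hc h0, ?_, ?_⟩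
    · rw [mul_smul_comm, map_smul, h1, smul_zero]
    · rw [coNorm_smul, mul_smul_comm, map_smul, h2, smul_zero]
  rcases M.eq_empty_or_nonempty with h | ⟨x, hxM⟩
  · exact ⟨0, by norm_num, by simp [h]⟩
  obtain ⟨hx0, hx1, hx2⟩ := (memM x).1 hxM
  by_cases hall : M ⊆ orb x
  · exact ⟨1, by norm_num, by
      rw [(orb_sub x hxM).antisymm hall |>.symm, orb_card x hx0, one_mul]⟩
  obtain ⟨y, hyM, hyx⟩ := Finset.not_subset.1 hall
  obtain ⟨hy0, hy1, hy2⟩ := (memM y).1 hyM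
  have hyc : ¬ ∃ c : F, y = c • x := by
    rintro ⟨c, rfl⟩
    exact hyx ((mem_orb _ _).2 ⟨c, fun h ↦ hy0 (by rw [h, zero_smul]), rfl⟩)
  have hB : Tr (γ * (σ x * σ (σ y) + σ y * σ (σ x))) ≠ 0 := fun h ↦
    hyc (exists_smul_eq_of_polar_eq_zero hK hγ hx0 hx2 hy2 h)
  -- The plane `Tr (β z) = 0` is spanned by `x` and `y`.
  have hspan : ∀ z, Tr (β * z) = 0 → ∃ c d : F, c • x + d • y = z := by
    have hli : Function.Injective fun p : F × F ↦ p.1 • x + p.2 • y := by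
      rintro ⟨c, d⟩ ⟨c', d'⟩ h
      dsimp only at h
      have hd : d = d' := by
        by_contra hne
        refine hyc ⟨(d - d')⁻¹ * (c' - c), ?_⟩
        rw [mul_smul, eq_inv_smul_iff₀ (sub_ne_zero.2 hne), sub_smul, sub_smul,
          sub_eq_sub_iff_add_eq_add, add_comm, h, add_comm]
      subst hd
      rw [smul_left_injective F hx0 (add_right_cancel h)]
    have himg : (Finset.univ.image fun p : F × F ↦ p.1 • x + p.2 • y) =
        Finset.univ.filter fun z : K ↦ Tr (β * z) = 0 := by
      refine Finset.eq_of_subset_of_card_le ?_ ?_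
      · intro z hz
        obtain ⟨p, -, rfl⟩ := Finset.mem_image.1 hz
        simp [mul_add, hx1, hy1]
      · rw [card_trace_mul_eq_zero hK hβ, Finset.card_image_of_injective _ hli, Finset.card_univ,
          Fintype.card_prod, sq]
    intro z hz
    have : z ∈ Finset.univ.image fun p : F × F ↦ p.1 • x + p.2 • y := by simp [himg, hz]
    obtain ⟨p, -, hp⟩ := Finset.mem_image.1 this
    exact ⟨p.1, p.2, hp⟩
  have hMeq : M = orb x ∪ orb y := by
    refine Finset.Subset.antisymm (fun z hz ↦ ?_)
      (Finset.union_subset (orb_sub x hxM) (orb_sub y hyM))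
    obtain ⟨hz0, hz1, hz2⟩ := (memM z).1 hz
    obtain ⟨c, d, rfl⟩ := hspan z hz1
    rw [trace_mul_coNorm_smul_add_smul, hx2, hy2, mul_zero, mul_zero, zero_add, add_zero] at hz2
    rw [Finset.mem_union, mem_orb, mem_orb]
    rcases mul_eq_zero.1 ((mul_eq_zero.1 hz2).resolve_right hB) with rfl | rfl
    · exact Or.inr ⟨d, fun h ↦ hz0 (by simp [h]), by simp⟩
    · exact Or.inl ⟨c, fun h ↦ hz0 (by simp [h]), by simp⟩
  have hdisj : Disjoint (orb x) (orb y) := by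
    refine Finset.disjoint_left.2 fun z hzx hzy ↦ hyc ?_
    obtain ⟨c, -, rfl⟩ := (mem_orb _ _).1 hzx
    obtain ⟨d, hd, h⟩ := (mem_orb _ _).1 hzy
    exact ⟨d⁻¹ * c, by rw [mul_smul, ← h, inv_smul_smul₀ hd]⟩
  exact ⟨2, le_rfl, by
    rw [hMeq, Finset.card_union_of_disjoint hdisj, orb_card x hx0, orb_card y hy0, two_mul]⟩

omit hK in
theorem pencilCount_eq_card_smul [Fintype K] [DecidableEq F] [DecidableEq K] (β γ : K) {c : F}
    (hc : c ≠ 0) : pencilCount (F := F) (β, γ) = ((Finset.univ.erase (0 : K)).filter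
      fun x ↦ Tr (β * x) + c * Tr (γ * coNorm F x) = 0).card := by
  have key : ∀ x : K, Tr (β * (c • x)) + Tr (γ * coNorm F (c • x)) =
      c * (Tr (β * x) + c * Tr (γ * coNorm F x)) := fun x ↦ by
    rw [coNorm_smul, mul_smul_comm, mul_smul_comm, map_smul, map_smul, smul_eq_mul, smul_eq_mul]
    ring
  symm
  refine Finset.card_nbij' (c • ·) (c⁻¹ • ·) ?_ ?_ ?_ ?_
  · intro x hx
    simp only [Finset.coe_filter, Finset.mem_erase, Finset.mem_univ, and_true,
      Set.mem_ofPred_eq] at hx ⊢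
    exact ⟨smul_ne_zero hc hx.1, by rw [key, hx.2, mul_zero]⟩
  · intro x hx
    simp only [Finset.coe_filter, Finset.mem_erase, Finset.mem_univ, and_true,
      Set.mem_ofPred_eq] at hx ⊢
    refine ⟨smul_ne_zero (inv_ne_zero hc) hx.1, ?_⟩
    refine (mul_eq_zero_iff_left hc).1 ?_
    rw [← key, smul_inv_smul₀ hc, hx.2]
  · intro x _
    exact inv_smul_smul₀ hc x
  · intro x _
    exact smul_inv_smul₀ hc x

omit [Field K] [Algebra F K] hK in
theorem card_ne_zero_add_mul_eq_zero [DecidableEq F] (l r : F) :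
    ((Finset.univ.erase (0 : F)).filter fun c ↦ l + c * r = 0).card +
      (if l = 0 then 1 else 0) + (if r = 0 then 1 else 0) =
    1 + Fintype.card F * (if l = 0 ∧ r = 0 then 1 else 0) := by
  have hF : 0 < Fintype.card F := Fintype.card_pos
  by_cases hr : r = 0
  · by_cases hl : l = 0
    · simp [hr, hl]
      omega
    · simp [hr, hl]
  · by_cases hl : l = 0
    · simp [hr, hl, Finset.filter_eq_empty_iff]
    · have : ((Finset.univ.erase (0 : F)).filter fun c ↦ l + c * r = 0) = {-l / r} := by
        ext c
        simp only [Finset.mem_filter, Finset.mem_erase, Finset.mem_univ, and_true,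
          Finset.mem_singleton]
        constructor
        · rintro ⟨-, h⟩
          rw [eq_div_iff hr]
          linear_combination h
        · rintro rfl
          exact ⟨div_ne_zero (neg_ne_zero.2 hl) hr, by field_simp; ring⟩
      simp [this, hr, hl]

/-- The possible sizes of the sections of `O` by hyperplanes through `0` and infinity. The zeros of
`Tr (β x) + c Tr (γ x^(q+q²))` have the same number for all scalars `c ≠ 0`; summing over `c` reduces
the count to the line `Tr (β x) = 0`, the conic `Tr (γ x^(q+q²)) = 0` and their intersection. -/
theorem exists_pencilCount_eq [Fintype K] [DecidableEq F] [DecidableEq K] {p : K × K}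
    (hp : p ≠ 0) : ∃ m ≤ 2, pencilCount (F := F) p + Fintype.card F + 1 =
      Fintype.card F ^ 2 + Fintype.card F * m := by
  obtain ⟨β, γ⟩ := p
  by_cases hβ : β = 0
  · have hγ : γ ≠ 0 := fun h ↦ hp (by rw [hβ, h]; rfl)
    refine ⟨1, by norm_num, ?_⟩
    have := card_ne_zero_trace_mul_coNorm_eq_zero hK hγ
    simp only [pencilCount, hβ, zero_mul, map_zero, zero_add]
    omega
  by_cases hγ : γ = 0
  · refine ⟨1, by norm_num, ?_⟩
    have := card_ne_zero_trace_mul_eq_zero hK hβ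
    simp only [pencilCount, hγ, zero_mul, map_zero, add_zero]
    omega
  obtain ⟨m, hm, hM⟩ := card_line_inter_conic hK hβ hγ
  refine ⟨m, hm, ?_⟩
  have hF : 1 < Fintype.card F := Fintype.one_lt_card
  have hL := card_ne_zero_trace_mul_eq_zero hK hβ
  have hQ := card_ne_zero_trace_mul_coNorm_eq_zero hK hγ
  have hX := card_erase_zero (F := F) hK
  have hsum : (Fintype.card F - 1) * pencilCount (F := F) (β, γ) =
      ∑ x ∈ Finset.univ.erase (0 : K), ((Finset.univ.erase (0 : F)).filter
        fun c ↦ Tr (β * x) + c * Tr (γ * coNorm F x) = 0).card := by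
    have h1 : ∑ c ∈ Finset.univ.erase (0 : F), ((Finset.univ.erase (0 : K)).filter
        fun x ↦ Tr (β * x) + c * Tr (γ * coNorm F x) = 0).card =
        (Fintype.card F - 1) * pencilCount (F := F) (β, γ) := by
      rw [Finset.sum_congr rfl fun c hc ↦
        (pencilCount_eq_card_smul β γ (Finset.ne_of_mem_erase hc)).symm, Finset.sum_const,
        Finset.card_erase_of_mem (Finset.mem_univ _), Finset.card_univ, smul_eq_mul]
    rw [← h1]
    exact Finset.sum_card_bipartiteAbove_eq_sum_card_bipartiteBelow
      (fun c x ↦ Tr (β * x) + c * Tr (γ * coNorm F x) = 0)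
  have hpt := Finset.sum_congr (rfl : Finset.univ.erase (0 : K) = _) fun x _ ↦
    card_ne_zero_add_mul_eq_zero (Tr (β * x)) (Tr (γ * coNorm F x))
  simp only [Finset.sum_add_distrib, ← Finset.mul_sum, ← Finset.card_filter, Finset.sum_const,
    smul_eq_mul, mul_one, ← hsum] at hpt
  rw [hM] at hpt
  obtain ⟨r, hr⟩ : ∃ r, Fintype.card F = r + 1 := ⟨Fintype.card F - 1, by omega⟩
  rw [hr, Nat.add_sub_cancel] at hpt
  rw [hr] at hL hQ hX ⊢
  have hr0 : 0 < r := by omega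
  refine Nat.eq_of_mul_eq_mul_left hr0 ?_
  zify at hL hQ hX hpt ⊢
  linear_combination hpt + hX - hL - hQ

end Pencil

/-! ### Moments over the sections through zero and infinity -/

section Moments

variable {F K : Type*} [Field F] [Fintype F] [Field K] [Algebra F K]

local notation "Tr" => Algebra.trace F K

/-- Evaluation at the point `x` of the forms `Tr (β x) + Tr (γ x^(q+q²))`, as a function of the pair
`(β, γ)`. -/
noncomputable def pencilEval (F : Type*) {K : Type*} [Field F] [Fintype F] [Field K] [Algebra F K]
    (x : K) : K × K →ₗ[F] F :=
  (Algebra.traceForm F K x).coprod (Algebra.traceForm F K (coNorm F x))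

theorem pencilEval_apply (x : K) (p : K × K) :
    pencilEval F x p = Tr (p.1 * x) + Tr (p.2 * coNorm F x) := by
  simp [pencilEval, LinearMap.coprod_apply, Algebra.traceForm_apply, mul_comm]

theorem finrank_forms (hK : Module.finrank F K = 3) :
    Module.finrank F (F × K × K × F) = 8 := by
  have : FiniteDimensional F K := Module.finite_of_finrank_pos (by omega)
  simp [Module.finrank_prod, hK]

theorem pencilEval_surjective (hK : Module.finrank F K = 3) {x : K} (hx : x ≠ 0) :
    Function.Surjective (pencilEval F x) := by
  refine LinearMap.surjective fun h ↦ hx ?_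
  refine eq_zero_of_forall_trace_mul_eq_zero hK fun β ↦ ?_
  have := DFunLike.congr_fun h (β, 0)
  simpa [pencilEval_apply, mul_comm] using this

/-- Any two distinct nonzero `x`, `y` impose independent conditions on `(β, γ)`: a relation would
give `y = c x` and `y^(q+q²) = c x^(q+q²)` with `c` in `F`, so `c² = c` and `y = x`. -/
theorem pencilEval_prod_surjective (hK : Module.finrank F K = 3) {x y : K} (hx : x ≠ 0)
    (hy : y ≠ 0) (hxy : x ≠ y) :
    Function.Surjective ((pencilEval F x).prod (pencilEval F y)) := by
  rw [← LinearMap.range_eq_top]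
  by_contra hlt
  obtain ⟨g, hg, hle⟩ := Submodule.exists_le_ker_of_lt_top _ (lt_top_iff_ne_top.2 hlt)
  set c := g (1, 0) with hc
  set d := g (0, 1) with hd
  have hgv : ∀ u v : F, g (u, v) = c * u + d * v := fun u v ↦ by
    have : ((u, v) : F × F) = u • (1, 0) + v • (0, 1) := by simp
    rw [this, map_add, map_smul, map_smul, smul_eq_mul, smul_eq_mul]
    ring
  have hrel : ∀ p, c * pencilEval F x p + d * pencilEval F y p = 0 := fun p ↦ by
    rw [← hgv]
    exact hle ⟨p, rfl⟩
  have h1 : c • x + d • y = 0 := eq_zero_of_forall_trace_mul_eq_zero hK fun β ↦ by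
    have := hrel (β, 0)
    simp only [pencilEval_apply, zero_mul, map_zero, add_zero] at this
    rw [add_mul, smul_mul_assoc, smul_mul_assoc, map_add, map_smul, map_smul, mul_comm x,
      mul_comm y]
    exact this
  have h2 : c • coNorm F x + d • coNorm F y = 0 :=
    eq_zero_of_forall_trace_mul_eq_zero hK fun γ ↦ by
      have := hrel (0, γ)
      simp only [pencilEval_apply, zero_mul, map_zero, zero_add] at this
      rw [add_mul, smul_mul_assoc, smul_mul_assoc, map_add, map_smul, map_smul,
        mul_comm (coNorm F x), mul_comm (coNorm F y)]
      exact this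
  have hd0 : d ≠ 0 := fun hd0 ↦ by
    rw [hd0, zero_smul, add_zero] at h1
    have hc0 := (smul_eq_zero.1 h1).resolve_right hx
    exact hg (LinearMap.ext fun p ↦ by rw [← Prod.mk.eta (p := p), hgv, hc0, hd0]; simp)
  obtain ⟨e, rfl⟩ : ∃ e : F, y = e • x := ⟨d⁻¹ * (-c), by
    rw [mul_smul, eq_inv_smul_iff₀ hd0, neg_smul]
    exact (neg_eq_of_add_eq_zero_right h1).symm⟩
  rw [coNorm_smul, smul_smul, ← add_smul] at h2
  rw [smul_smul, ← add_smul] at h1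
  have h1' := (smul_eq_zero.1 h1).resolve_right hx
  have h2' := (smul_eq_zero.1 h2).resolve_right (coNorm_ne_zero hx)
  have he0 : e ≠ 0 := fun h ↦ hy (by rw [h, zero_smul])
  have he : d * e * (e - 1) = 0 := by linear_combination h2' - h1'
  have := sub_eq_zero.1 ((mul_eq_zero.1 he).resolve_left (mul_ne_zero hd0 he0))
  exact hxy (by rw [this, one_smul])

variable [Fintype K] [DecidableEq F] [DecidableEq K]

theorem sum_pencilCount (hK : Module.finrank F K = 3) :
    ∑ p : K × K, pencilCount (F := F) p = (Fintype.card F ^ 3 - 1) * Fintype.card F ^ 5 := by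
  have hX := card_erase_zero (F := F) hK
  have : FiniteDimensional F K := Module.finite_of_finrank_pos (by omega)
  calc ∑ p : K × K, pencilCount (F := F) p
      = ∑ x ∈ Finset.univ.erase (0 : K),
        (Finset.univ.filter fun p : K × K ↦ Tr (p.1 * x) + Tr (p.2 * coNorm F x) = 0).card :=
        Finset.sum_card_bipartiteAbove_eq_sum_card_bipartiteBelow
          (fun (p : K × K) x ↦ Tr (p.1 * x) + Tr (p.2 * coNorm F x) = 0)
    _ = ∑ x ∈ Finset.univ.erase (0 : K), Fintype.card F ^ 5 := by
        refine Finset.sum_congr rfl fun x hx ↦ ?_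
        simp only [← pencilEval_apply]
        refine card_filter_eq_zero_of_surjective
          (pencilEval_surjective hK (Finset.ne_of_mem_erase hx)) ?_
        rw [Module.finrank_prod, hK, Module.finrank_self]
    _ = _ := by rw [Finset.sum_const, smul_eq_mul, ← hX, Nat.add_sub_cancel]

theorem sum_pencilCount_offDiag (hK : Module.finrank F K = 3) :
    ∑ p : K × K, (pencilCount (F := F) p * pencilCount (F := F) p - pencilCount (F := F) p) =
      (Fintype.card F ^ 3 - 1) * (Fintype.card F ^ 3 - 2) * Fintype.card F ^ 4 := by
  have hX := card_erase_zero (F := F) hK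
  have : FiniteDimensional F K := Module.finite_of_finrank_pos (by omega)
  calc ∑ p : K × K, (pencilCount (F := F) p * pencilCount (F := F) p - pencilCount (F := F) p)
      = ∑ p : K × K, ((Finset.univ.erase (0 : K)).offDiag.filter fun xy ↦
          ((pencilEval F xy.1).prod (pencilEval F xy.2)) p = 0).card := by
        refine Finset.sum_congr rfl fun p _ ↦ ?_
        rw [pencilCount, ← Finset.offDiag_card]
        congr 1
        ext xy
        simp only [Finset.mem_offDiag, Finset.mem_filter, LinearMap.prod_apply, Function.prod_apply,
          Prod.mk_eq_zero, pencilEval_apply]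
        tauto
    _ = ∑ xy ∈ (Finset.univ.erase (0 : K)).offDiag, (Finset.univ.filter fun p : K × K ↦
          ((pencilEval F xy.1).prod (pencilEval F xy.2)) p = 0).card :=
        Finset.sum_card_bipartiteAbove_eq_sum_card_bipartiteBelow
          (fun (p : K × K) (xy : K × K) ↦ ((pencilEval F xy.1).prod (pencilEval F xy.2)) p = 0)
    _ = ∑ xy ∈ (Finset.univ.erase (0 : K)).offDiag, Fintype.card F ^ 4 := by
        refine Finset.sum_congr rfl fun xy hxy ↦ ?_
        obtain ⟨h1, h2, h3⟩ := Finset.mem_offDiag.1 hxy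
        refine card_filter_eq_zero_of_surjective (pencilEval_prod_surjective hK
          (Finset.ne_of_mem_erase h1) (Finset.ne_of_mem_erase h2) h3) ?_
        rw [Module.finrank_prod, Module.finrank_prod, hK, Module.finrank_self]
    _ = _ := by
        rw [Finset.sum_const, smul_eq_mul, Finset.offDiag_card, ← hX, Nat.add_sub_cancel,
          ← Nat.mul_sub_one]
        rfl

end Moments

/-- The multiplicities of a function with values in `{a, a + d, a + 2d}` are determined by its first
two moments. -/
theorem card_filter_of_three_values {ι : Type*} (s : Finset ι) (w : ι → ℚ) {a d : ℚ} (hd : d ≠ 0)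
    (h : ∀ i ∈ s, w i = a ∨ w i = a + d ∨ w i = a + 2 * d) :
    2 * d ^ 2 * (s.filter fun i ↦ w i = a).card = ∑ i ∈ s, w i ^ 2 - (2 * a + 3 * d) * ∑ i ∈ s, w i
      + (a + d) * (a + 2 * d) * s.card ∧
    d ^ 2 * (s.filter fun i ↦ w i = a + d).card = -∑ i ∈ s, w i ^ 2 +
      (2 * a + 2 * d) * ∑ i ∈ s, w i - a * (a + 2 * d) * s.card ∧
    2 * d ^ 2 * (s.filter fun i ↦ w i = a + 2 * d).card = ∑ i ∈ s, w i ^ 2 -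
      (2 * a + d) * ∑ i ∈ s, w i + a * (a + d) * s.card := by
  have h2d : a ≠ a + 2 * d := by simpa using hd
  have h1d : a ≠ a + d := by simpa using hd
  have h12 : a + d ≠ a + 2 * d := fun h ↦ hd (by linarith)
  simp only [Finset.card_eq_sum_ones, Finset.sum_filter, Nat.cast_sum, Finset.mul_sum,
    ← Finset.sum_sub_distrib, ← Finset.sum_add_distrib, ← Finset.sum_neg_distrib]
  refine ⟨Finset.sum_congr rfl fun i hi ↦ ?_, Finset.sum_congr rfl fun i hi ↦ ?_,
    Finset.sum_congr rfl fun i hi ↦ ?_⟩ <;>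
  rcases h i hi with h | h | h <;> rw [h] <;>
  simp only [h2d, h1d, h12, h2d.symm, h1d.symm, h12.symm, if_true, if_false] <;> push_cast <;> ring

/-! ### The distribution of section sizes -/

section Sections

variable {F K : Type*} [Field F] [Fintype F] [Field K] [Algebra F K]
  [Fintype K] [DecidableEq F] [DecidableEq K]

theorem pencilCount_zero (hK : Module.finrank F K = 3) :
    pencilCount (F := F) (0 : K × K) + 1 = Fintype.card F ^ 3 := by
  rw [← card_erase_zero (F := F) hK]
  simp [pencilCount]

/-- The first two moments of `pencilCount`, with the exceptional pair `0` removed, give the number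
of pairs `(β, γ)` for each of the three values of `exists_pencilCount_eq`. -/
theorem card_filter_pencilCount_eq (hK : Module.finrank F K = 3) {q : ℚ}
    (hq : (Fintype.card F : ℚ) = q) :
    let N : ℚ → ℚ := fun w ↦
      ((Finset.univ.erase (0 : K × K)).filter fun p ↦ (pencilCount (F := F) p : ℚ) = w).card
    N (q ^ 2 - q - 1) = 1 / 2 * q * (q ^ 3 - 1) * (q - 1) ^ 2 ∧
    N (q ^ 2 - q - 1 + q) = (q ^ 3 - 1) * (q ^ 2 + 1) ∧
    N (q ^ 2 - q - 1 + 2 * q) = 1 / 2 * q * (q ^ 3 - 1) * (q ^ 2 - 1) := by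
  intro N
  have hq0 : q ≠ 0 := by
    rw [← hq]
    exact_mod_cast Fintype.card_ne_zero
  have hF : 1 < Fintype.card F := Fintype.one_lt_card
  have hF3 : 2 ≤ Fintype.card F ^ 3 :=
    le_trans hF (Nat.le_self_pow (by norm_num) _)
  have hw0 : (pencilCount (F := F) (0 : K × K) : ℚ) = q ^ 3 - 1 := by
    rw [← hq, eq_sub_iff_add_eq]
    exact_mod_cast pencilCount_zero hK
  have hS0 : ((Finset.univ.erase (0 : K × K)).card : ℚ) = q ^ 6 - 1 := by
    rw [Finset.card_erase_of_mem (Finset.mem_univ _), Finset.card_univ, Fintype.card_prod,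
      card_eq_card_pow_three (F := F) hK, Nat.cast_sub (by nlinarith), ← hq]
    push_cast
    ring
  have hS1 : ∑ p ∈ Finset.univ.erase (0 : K × K), (pencilCount (F := F) p : ℚ) =
      (q ^ 3 - 1) * q ^ 5 - (q ^ 3 - 1) := by
    rw [Finset.sum_erase_eq_sub (Finset.mem_univ _), hw0, ← Nat.cast_sum, sum_pencilCount hK,
      Nat.cast_mul, Nat.cast_sub (by omega), ← hq]
    push_cast
    ring
  have hS2 : ∑ p ∈ Finset.univ.erase (0 : K × K), (pencilCount (F := F) p : ℚ) ^ 2 =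
      (q ^ 3 - 1) * (q ^ 3 - 2) * q ^ 4 + (q ^ 3 - 1) * q ^ 5 - (q ^ 3 - 1) ^ 2 := by
    have h2 := congrArg (Nat.cast : ℕ → ℚ) (sum_pencilCount_offDiag (F := F) (K := K) hK)
    have h1 := congrArg (Nat.cast : ℕ → ℚ) (sum_pencilCount (F := F) (K := K) hK)
    rw [Nat.cast_sum] at h1 h2
    rw [Finset.sum_congr rfl fun p _ ↦ Nat.cast_sub (Nat.le_mul_self _),
      Finset.sum_sub_distrib, h1] at h2
    rw [Finset.sum_erase_eq_sub (Finset.mem_univ _), hw0]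
    simp only [← pow_two, Nat.cast_mul, Nat.cast_pow] at h2
    rw [sub_eq_iff_eq_add.1 h2]
    rw [Nat.cast_sub (by omega), Nat.cast_sub (by omega)]
    push_cast
    rw [hq]
  have hval : ∀ p ∈ Finset.univ.erase (0 : K × K), (pencilCount (F := F) p : ℚ) = q ^ 2 - q - 1 ∨
      (pencilCount (F := F) p : ℚ) = q ^ 2 - q - 1 + q ∨
      (pencilCount (F := F) p : ℚ) = q ^ 2 - q - 1 + 2 * q := fun p hp ↦ by
    obtain ⟨m, hm, h⟩ := exists_pencilCount_eq (F := F) hK (Finset.ne_of_mem_erase hp)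
    have h' := congrArg (Nat.cast : ℕ → ℚ) h
    push_cast at h'
    rw [hq] at h'
    interval_cases m
    · left; push_cast at h'; linear_combination h'
    · right; left; push_cast at h'; linear_combination h'
    · right; right; push_cast at h'; linear_combination h'
  obtain ⟨e0, e1, e2⟩ := card_filter_of_three_values _ _ hq0 hval
  rw [hS0, hS1, hS2] at e0 e1 e2
  have hq2 : q ^ 2 ≠ 0 := pow_ne_zero 2 hq0
  refine ⟨?_, ?_, ?_⟩
  · refine mul_left_cancel₀ (mul_ne_zero two_ne_zero hq2) (e0.trans ?_)
    ring
  · refine mul_left_cancel₀ hq2 (e1.trans ?_)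
    ring
  · refine mul_left_cancel₀ (mul_ne_zero two_ne_zero hq2) (e2.trans ?_)
    ring

/-- The points of `O` on the hyperplane with the given coefficients. -/
noncomputable def sectionPoints (f : F × K × K × F) : Finset (Option K) :=
  Finset.univ.filter fun P ↦ ovoidForm F K f P = 0

/-- The number of linear forms vanishing on exactly `z` points of `O`; the zero form is included and
contributes to `z = q³ + 1`. -/
noncomputable def sectionCount (F K : Type*) [Field F] [Fintype F] [Field K] [Algebra F K]
    [Fintype K] [DecidableEq F] (z : ℕ) : ℕ :=
  (Finset.univ.filter fun f : F × K × K × F ↦ (sectionPoints f).card = z).card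

theorem card_sectionPoints_pencil (p : K × K) :
    (sectionPoints (F := F) (0, p.1, p.2, 0)).card = pencilCount (F := F) p + 2 := by
  have : sectionPoints (F := F) (0, p.1, p.2, 0) = insert none (insert (some 0)
      (((Finset.univ.erase (0 : K)).filter fun x ↦ Algebra.trace F K (p.1 * x) +
        Algebra.trace F K (p.2 * coNorm F x) = 0).map Function.Embedding.some)) := by
    ext P
    cases P with
    | none => simp [sectionPoints, ovoidForm_none]
    | some x =>
      by_cases hx : x = 0
      · subst hx
        simp [sectionPoints, ovoidForm_some, coNorm_zero]
      · simp [sectionPoints, ovoidForm_some, hx]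
  rw [this, Finset.card_insert_of_notMem (by simp), Finset.card_insert_of_notMem (by simp),
    Finset.card_map, pencilCount]

theorem card_forms_through_none_zero (z : ℕ) :
    (Finset.univ.filter fun f : F × K × K × F ↦ (sectionPoints f).card = z ∧
      ovoidForm F K f none = 0 ∧ ovoidForm F K f (some 0) = 0).card =
    (Finset.univ.filter fun p : K × K ↦ pencilCount (F := F) p + 2 = z).card := by
  symm
  refine Finset.card_nbij' (fun p ↦ (0, p.1, p.2, 0)) (fun f ↦ (f.2.1, f.2.2.1)) ?_ ?_ ?_ ?_
  · intro p hp
    simp only [Finset.coe_filter, Finset.mem_univ, true_and, Set.mem_ofPred_eq] at hp ⊢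
    exact ⟨by rw [card_sectionPoints_pencil, hp], rfl, by simp [ovoidForm_some, coNorm_zero]⟩
  · rintro ⟨a, β, γ, d⟩ hf
    simp only [Finset.coe_filter, Finset.mem_univ, true_and, Set.mem_ofPred_eq] at hf ⊢
    obtain ⟨h, h0, h1⟩ := hf
    obtain rfl : d = 0 := h0
    obtain rfl : a = 0 := by simpa [ovoidForm_some, coNorm_zero] using h1
    rw [← card_sectionPoints_pencil, h]
  · intro p _
    rfl
  · rintro ⟨a, β, γ, d⟩ hf
    simp only [Finset.coe_filter, Finset.mem_univ, true_and, Set.mem_ofPred_eq] at hf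
    obtain ⟨h, h0, h1⟩ := hf
    obtain rfl : d = 0 := h0
    obtain rfl : a = 0 := by simpa [ovoidForm_some, coNorm_zero] using h1
    rfl

theorem card_forms_through_pair (hK : Module.finrank F K = 3) (z : ℕ) {P Q : Option K}
    (hPQ : P ≠ Q) :
    (Finset.univ.filter fun f : F × K × K × F ↦ (sectionPoints f).card = z ∧
      ovoidForm F K f P = 0 ∧ ovoidForm F K f Q = 0).card =
    (Finset.univ.filter fun p : K × K ↦ pencilCount (F := F) p + 2 = z).card := by
  rw [← card_forms_through_none_zero]
  obtain ⟨π, ⟨φ, hφ, h⟩, rfl, rfl⟩ := exists_preservesSections hK hPQ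
  refine Finset.card_bijective φ (Finite.injective_iff_bijective.1 hφ) fun f ↦ ?_
  have hcard : (sectionPoints (φ f)).card = (sectionPoints f).card := by
    refine Finset.card_equiv π fun P ↦ ?_
    simp [sectionPoints, h]
  simp [hcard, h]

/-- Double counting of the pairs of distinct points on the sections of size `z`. -/
theorem sectionCount_mul (hK : Module.finrank F K = 3) (z : ℕ) :
    sectionCount F K z * (z * z - z) = (Fintype.card F ^ 3 + 1) * Fintype.card F ^ 3 *
      (Finset.univ.filter fun p : K × K ↦ pencilCount (F := F) p + 2 = z).card := by
  calc sectionCount F K z * (z * z - z)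
      = ∑ f ∈ Finset.univ.filter fun f : F × K × K × F ↦ (sectionPoints f).card = z,
          (Finset.univ.offDiag.filter fun PQ : Option K × Option K ↦
            ovoidForm F K f PQ.1 = 0 ∧ ovoidForm F K f PQ.2 = 0).card := by
        rw [sectionCount, ← smul_eq_mul, ← Finset.sum_const]
        refine Finset.sum_congr rfl fun f hf ↦ ?_
        rw [← (Finset.mem_filter.1 hf).2, ← Finset.offDiag_card]
        congr 1
        ext PQ
        simp only [Finset.mem_offDiag, Finset.mem_filter, Finset.mem_univ, true_and, sectionPoints]
        tauto
    _ = ∑ PQ ∈ (Finset.univ : Finset (Option K)).offDiag,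
          ((Finset.univ.filter fun f : F × K × K × F ↦ (sectionPoints f).card = z).filter fun f ↦
            ovoidForm F K f PQ.1 = 0 ∧ ovoidForm F K f PQ.2 = 0).card :=
        Finset.sum_card_bipartiteAbove_eq_sum_card_bipartiteBelow
          (fun (f : F × K × K × F) (PQ : Option K × Option K) ↦
            ovoidForm F K f PQ.1 = 0 ∧ ovoidForm F K f PQ.2 = 0)
    _ = ∑ PQ ∈ (Finset.univ : Finset (Option K)).offDiag,
          (Finset.univ.filter fun p : K × K ↦ pencilCount (F := F) p + 2 = z).card := by
        refine Finset.sum_congr rfl fun PQ hPQ ↦ ?_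
        rw [Finset.filter_filter]
        exact card_forms_through_pair hK z (Finset.mem_offDiag.1 hPQ).2.2
    _ = _ := by
        rw [Finset.sum_const, smul_eq_mul, Finset.offDiag_card, Finset.card_univ,
          Fintype.card_option, card_eq_card_pow_three (F := F) hK, ← Nat.mul_sub_one,
          Nat.add_sub_cancel]

omit [Fintype K] [DecidableEq F] [DecidableEq K] in
theorem ovoidForm_apply_surjective (P : Option K) :
    Function.Surjective ((LinearMap.proj P : (Option K → F) →ₗ[F] F) ∘ₗ ovoidForm F K) := by
  cases P with
  | none => exact fun c ↦ ⟨(0, 0, 0, c), rfl⟩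
  | some x => exact fun c ↦ ⟨(c, 0, 0, 0), by simp [ovoidForm_some]⟩

omit [DecidableEq K] in
theorem sum_card_sectionPoints (hK : Module.finrank F K = 3) :
    ∑ f : F × K × K × F, (sectionPoints f).card =
      (Fintype.card F ^ 3 + 1) * Fintype.card F ^ 7 := by
  have : FiniteDimensional F K := Module.finite_of_finrank_pos (by omega)
  calc ∑ f : F × K × K × F, (sectionPoints f).card
      = ∑ P : Option K, (Finset.univ.filter fun f : F × K × K × F ↦ ovoidForm F K f P = 0).card :=
        Finset.sum_card_bipartiteAbove_eq_sum_card_bipartiteBelow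
          (fun (f : F × K × K × F) P ↦ ovoidForm F K f P = 0)
    _ = ∑ P : Option K, Fintype.card F ^ 7 := by
        refine Finset.sum_congr rfl fun P _ ↦ ?_
        refine card_filter_eq_zero_of_surjective
          (ℓ := (LinearMap.proj P : (Option K → F) →ₗ[F] F) ∘ₗ ovoidForm F K)
          (ovoidForm_apply_surjective P) ?_
        rw [finrank_forms hK, Module.finrank_self]
    _ = _ := by
        rw [Finset.sum_const, smul_eq_mul, Finset.card_univ, Fintype.card_option,
          card_eq_card_pow_three (F := F) hK]

/-- The distribution of the section sizes. Sizes `z ≥ 2` are read off from double counting. The total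
number of forms and of incidences with points then leave no form without zeros on `O`, and fix the
number of forms with a single zero. -/
theorem sectionCount_eq (hK : Module.finrank F K = 3) {n : ℕ} (hn : Fintype.card F = n)
    {q : ℚ} (hq : (n : ℚ) = q) :
    (sectionCount F K (n ^ 2 + n + 1) : ℚ) = 1 / 2 * q ^ 3 * (q ^ 3 + 1) * (q - 1) ^ 2 ∧
    (sectionCount F K (n ^ 2 + 1) : ℚ) = q * (q ^ 6 - 1) ∧
    (sectionCount F K (n ^ 2 - n + 1) : ℚ) = 1 / 2 * q ^ 3 * (q ^ 3 - 1) * (q ^ 2 - 1) ∧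
    (sectionCount F K 1 : ℚ) = (q ^ 3 + 1) * (q - 1) ∧
    sectionCount F K (n ^ 3 + 1) = 1 ∧
    ∀ z, z ≠ n ^ 2 + n + 1 → z ≠ n ^ 2 + 1 → z ≠ n ^ 2 - n + 1 → z ≠ 1 → z ≠ n ^ 3 + 1 →
      sectionCount F K z = 0 := by
  have hn2 : 2 ≤ n := hn ▸ Fintype.one_lt_card
  obtain ⟨k, rfl⟩ : ∃ k, n = k + 2 := ⟨n - 2, by omega⟩
  have hsub : (k + 2) ^ 2 - (k + 2) + 1 = k ^ 2 + 3 * k + 3 := by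
    have : (k + 2) ^ 2 = k ^ 2 + 3 * k + 2 + (k + 2) := by ring
    rw [this, Nat.add_sub_cancel]
  have hqk : q = k + 2 := by rw [← hq]; push_cast; rfl
  have hzero : pencilCount (F := F) (0 : K × K) + 2 = (k + 2) ^ 3 + 1 := by
    have := pencilCount_zero (F := F) (K := K) hK
    rw [hn] at this
    omega
  have hlt : (k + 2) ^ 2 + (k + 2) + 1 < (k + 2) ^ 3 + 1 := by ring_nf; nlinarith
  -- Away from `z = q³ + 1`, the zero pair can be left out of the count.
  have herase : ∀ z, z ≠ (k + 2) ^ 3 + 1 →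
      (Finset.univ.filter fun p : K × K ↦ pencilCount (F := F) p + 2 = z) =
      (Finset.univ.erase 0).filter fun p : K × K ↦ (pencilCount (F := F) p : ℚ) = z - 2 := by
    intro z hz
    ext p
    simp only [Finset.mem_filter, Finset.mem_univ, true_and, Finset.mem_erase, and_true]
    rw [eq_sub_iff_add_eq]
    norm_cast
    constructor
    · refine fun h ↦ ⟨?_, h⟩
      rintro rfl
      exact hz (h.symm.trans hzero)
    · exact fun h ↦ h.2
  have hmul : ∀ z, (sectionCount F K z : ℚ) * (z * z - z) = (q ^ 3 + 1) * q ^ 3 *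
      (Finset.univ.filter fun p : K × K ↦ pencilCount (F := F) p + 2 = z).card := by
    intro z
    have := congrArg (Nat.cast : ℕ → ℚ) (sectionCount_mul (F := F) (K := K) hK z)
    rw [Nat.cast_mul, Nat.cast_sub (Nat.le_mul_self z), hn] at this
    push_cast at this
    rw [this, hqk]
  obtain ⟨c0, c1, c2⟩ := card_filter_pencilCount_eq (F := F) (K := K) hK
    (q := q) (by rw [hn, hq])
  beta_reduce at c0 c1 c2
  have h2 : (sectionCount F K ((k + 2) ^ 2 + (k + 2) + 1) : ℚ) =
      1 / 2 * q ^ 3 * (q ^ 3 + 1) * (q - 1) ^ 2 := by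
    have h := hmul ((k + 2) ^ 2 + (k + 2) + 1)
    rw [herase _ hlt.ne, show (((k + 2) ^ 2 + (k + 2) + 1 : ℕ) : ℚ) - 2 = q ^ 2 - q - 1 + 2 * q by
      rw [hqk]; push_cast; ring, c2] at h
    have hz : (((k + 2) ^ 2 + (k + 2) + 1 : ℕ) : ℚ) = q ^ 2 + q + 1 := by rw [hqk]; push_cast; rfl
    rw [hz] at h
    have hne : (q ^ 2 + q + 1) * (q ^ 2 + q + 1) - (q ^ 2 + q + 1) ≠ 0 := by
      rw [show (q ^ 2 + q + 1) * (q ^ 2 + q + 1) - (q ^ 2 + q + 1) =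
        (q ^ 2 + q + 1) * (q ^ 2 + q) by ring, hqk]
      positivity
    refine mul_right_cancel₀ hne (h.trans ?_)
    ring
  have h1 : (sectionCount F K ((k + 2) ^ 2 + 1) : ℚ) = q * (q ^ 6 - 1) := by
    have h := hmul ((k + 2) ^ 2 + 1)
    rw [herase _ (by omega), show (((k + 2) ^ 2 + 1 : ℕ) : ℚ) - 2 = q ^ 2 - q - 1 + q by
      rw [hqk]; push_cast; ring, c1] at h
    have hz : (((k + 2) ^ 2 + 1 : ℕ) : ℚ) = q ^ 2 + 1 := by rw [hqk]; push_cast; rfl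
    rw [hz] at h
    have hne : (q ^ 2 + 1) * (q ^ 2 + 1) - (q ^ 2 + 1) ≠ 0 := by
      rw [show (q ^ 2 + 1) * (q ^ 2 + 1) - (q ^ 2 + 1) = (q ^ 2 + 1) * q ^ 2 by ring, hqk]
      positivity
    refine mul_right_cancel₀ hne (h.trans ?_)
    ring
  have h0 : (sectionCount F K ((k + 2) ^ 2 - (k + 2) + 1) : ℚ) =
      1 / 2 * q ^ 3 * (q ^ 3 - 1) * (q ^ 2 - 1) := by
    rw [hsub]
    have h := hmul (k ^ 2 + 3 * k + 3)
    have hz : ((k ^ 2 + 3 * k + 3 : ℕ) : ℚ) = q ^ 2 - q + 1 := by rw [hqk]; push_cast; ring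
    rw [herase _ (by nlinarith), hz, show q ^ 2 - q + 1 - 2 = q ^ 2 - q - 1 by ring, c0] at h
    have hne : (q ^ 2 - q + 1) * (q ^ 2 - q + 1) - (q ^ 2 - q + 1) ≠ 0 := by
      rw [show (q ^ 2 - q + 1) * (q ^ 2 - q + 1) - (q ^ 2 - q + 1) =
        (k ^ 2 + 3 * k + 3) * ((k + 2) * (k + 1)) by rw [hqk]; ring]
      positivity
    refine mul_right_cancel₀ hne (h.trans ?_)
    ring
  -- Sizes other than `0`, `1` are those met on the sections through `0` and infinity.
  have hother : ∀ z, z ≠ (k + 2) ^ 2 + (k + 2) + 1 → z ≠ (k + 2) ^ 2 + 1 →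
      z ≠ k ^ 2 + 3 * k + 3 → z ≠ 0 → z ≠ 1 → z ≠ (k + 2) ^ 3 + 1 → sectionCount F K z = 0 := by
    intro z z2 z1 z0 hz0 hz1 hz3
    have h := sectionCount_mul (F := F) (K := K) hK z
    have hempty : (Finset.univ.filter fun p : K × K ↦ pencilCount (F := F) p + 2 = z) = ∅ := by
      refine Finset.filter_eq_empty_iff.2 fun p _ hp ↦ ?_
      by_cases hp0 : p = 0
      · subst hp0
        exact hz3 (hp.symm.trans hzero)
      · obtain ⟨m, hm, hpm⟩ := exists_pencilCount_eq (F := F) hK hp0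
        rw [hn] at hpm
        have e : (k + 2) ^ 2 = k ^ 2 + 4 * k + 4 := by ring
        interval_cases m <;> omega
    rw [hempty, Finset.card_empty, mul_zero, ← Nat.mul_sub_one] at h
    rcases Nat.mul_eq_zero.1 h with h | h
    · exact h
    · rcases Nat.mul_eq_zero.1 h with h | h <;> omega
  have h3 : sectionCount F K ((k + 2) ^ 3 + 1) = 1 := by
    have h := sectionCount_mul (F := F) (K := K) hK ((k + 2) ^ 3 + 1)
    have hsing : (Finset.univ.filter fun p : K × K ↦
        pencilCount (F := F) p + 2 = (k + 2) ^ 3 + 1) = {0} := by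
      ext p
      simp only [Finset.mem_filter, Finset.mem_univ, true_and, Finset.mem_singleton]
      refine ⟨fun hp ↦ ?_, fun hp ↦ hp ▸ hzero⟩
      by_contra hp0
      obtain ⟨m, hm, hpm⟩ := exists_pencilCount_eq (F := F) hK hp0
      rw [hn] at hpm
      interval_cases m <;> omega
    rw [hsing, Finset.card_singleton, ← Nat.mul_sub_one, Nat.add_sub_cancel, hn, mul_one] at h
    exact Nat.eq_of_mul_eq_mul_right (by positivity) (h.trans (one_mul _).symm)
  let T : Finset ℕ := {0, 1, k ^ 2 + 3 * k + 3, (k + 2) ^ 2 + 1, (k + 2) ^ 2 + (k + 2) + 1,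
    (k + 2) ^ 3 + 1}
  have hT : ∀ f ∈ (Finset.univ : Finset (F × K × K × F)), (sectionPoints f).card ∈ T := by
    intro f _
    by_contra hf
    simp only [T, Finset.mem_insert, Finset.mem_singleton, not_or] at hf
    obtain ⟨f0, f1, f2, f3, f4, f5⟩ := hf
    have := hother _ f4 f3 f2 f0 f1 f5
    rw [sectionCount, Finset.card_eq_zero, Finset.filter_eq_empty_iff] at this
    exact this (Finset.mem_univ f) rfl
  have hTsum : ∀ g : ℕ → ℚ, ∑ z ∈ T, g z = g 0 + (g 1 + (g (k ^ 2 + 3 * k + 3) +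
      (g ((k + 2) ^ 2 + 1) + (g ((k + 2) ^ 2 + (k + 2) + 1) + g ((k + 2) ^ 3 + 1))))) := by
    intro g
    have e : (k + 2) ^ 2 = k ^ 2 + 4 * k + 4 := by ring
    have : ∀ a b c d e f : ℕ, a < b → b < c → c < d → d < e → e < f →
        ∑ z ∈ ({a, b, c, d, e, f} : Finset ℕ), g z =
          g a + (g b + (g c + (g d + (g e + g f)))) := by
      intro a b c d e f hab hbc hcd hde hef
      rw [Finset.sum_insert, Finset.sum_insert, Finset.sum_insert, Finset.sum_insert,
        Finset.sum_pair] <;> (try simp only [Finset.mem_insert, Finset.mem_singleton]) <;> omega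
    exact this _ _ _ _ _ _ (by omega) (by omega) (by omega) (by omega) hlt
  have hcount : q ^ 8 = ∑ z ∈ T, (sectionCount F K z : ℚ) := by
    have := Finset.card_eq_sum_card_fiberwise hT
    rw [Finset.card_univ, Module.card_eq_pow_finrank (K := F), finrank_forms hK, hn] at this
    rw [← hq]
    exact_mod_cast this
  have hincid : (q ^ 3 + 1) * q ^ 7 = ∑ z ∈ T, (sectionCount F K z : ℚ) * z := by
    have h := sum_card_sectionPoints (F := F) (K := K) hK
    rw [← Finset.sum_fiberwise_of_maps_to hT, hn] at h
    have h' : ∀ z ∈ T, (∑ f ∈ Finset.univ.filter fun f : F × K × K × F ↦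
        (sectionPoints f).card = z, (sectionPoints f).card) = sectionCount F K z * z := by
      intro z _
      rw [Finset.sum_congr rfl fun f hf ↦ (Finset.mem_filter.1 hf).2, Finset.sum_const,
        smul_eq_mul, sectionCount]
    rw [Finset.sum_congr rfl h'] at h
    rw [← hq]
    exact_mod_cast h.symm
  rw [hTsum] at hcount hincid
  rw [hsub] at h0
  rw [h0, h1, h2, h3] at hcount hincid
  push_cast at hcount hincid
  rw [hqk] at h0 h1 h2 hcount hincid ⊢
  have hone : (sectionCount F K 1 : ℚ) = (((k : ℚ) + 2) ^ 3 + 1) * ((k : ℚ) + 2 - 1) := by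
    linear_combination -hincid
  have hzero' : (sectionCount F K 0 : ℚ) = 0 := by
    rw [hone] at hcount
    linear_combination -hcount
  refine ⟨h2, h1, ?_, hone, h3, ?_⟩
  · rw [hsub]
    exact h0
  · intro z z2 z1 z0 hz1 hz3
    by_cases hz : z = 0
    · subst hz
      exact_mod_cast hzero'
    · exact hother z z2 z1 (hsub ▸ z0) hz hz1 hz3

end Sections

/-! ### The code -/

section Code

variable {F K : Type*} [Field F] [Fintype F] [Field K] [Algebra F K]

/-- The indexing of the points of `O` by the columns of the matrix: the last column is the point at
infinity. -/
def columnPoint {n : ℕ} (x : Fin n ≃ K) : Fin (n + 1) ≃ Option K :=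
  finSuccEquivLast.trans (Equiv.optionCongr x)

omit [Field K] in
theorem columnPoint_castSucc {n : ℕ} (x : Fin n ≃ K) (k : Fin n) :
    columnPoint x k.castSucc = some (x k) := by
  simp [columnPoint]

omit [Field K] in
theorem columnPoint_last {n : ℕ} (x : Fin n ≃ K) : columnPoint x (Fin.last n) = none := by
  simp [columnPoint]

/-- The codeword of a linear form: its values at the columns. -/
noncomputable def codewordMap (F : Type*) {K : Type*} [Field F] [Fintype F] [Field K] [Algebra F K]
    {n : ℕ} (x : Fin n ≃ K) : F × K × K × F →ₗ[F] Fin (n + 1) → F :=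
  LinearMap.funLeft F F (columnPoint x) ∘ₗ ovoidForm F K

theorem codewordMap_apply {n : ℕ} (x : Fin n ≃ K) (f : F × K × K × F) (j : Fin (n + 1)) :
    codewordMap F x f j = ovoidForm F K f (columnPoint x j) := rfl

/-- The linear forms evaluated by the rows of the matrix. -/
def rowForm (F : Type*) {K : Type*} [Field F] [Field K] (θ : K) : Fin 8 → F × K × K × F :=
  ![(1, 0, 0, 0), (0, 1, 0, 0), (0, θ, 0, 0), (0, θ ^ 2, 0, 0), (0, 0, 1, 0), (0, 0, θ, 0),
    (0, 0, θ ^ 2, 0), (0, 0, 0, 1)]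

theorem ovoidMatrix_row (θ : K) (x : Fin (Fintype.card F ^ 3) ≃ K) (i : Fin 8) :
    ovoidMatrix F (Fintype.card F) θ x i = codewordMap F x (rowForm F θ i) := by
  funext j
  rw [codewordMap_apply]
  induction j using Fin.lastCases with
  | last =>
    rw [columnPoint_last, ovoidForm_none]
    fin_cases i <;> simp [ovoidMatrix, rowForm]
  | cast k =>
    rw [columnPoint_castSucc, ovoidForm_some]
    fin_cases i <;> simp [ovoidMatrix, ovoidColumn, rowForm, coNorm_eq_pow]

omit [Fintype F] in
theorem exists_eq_smul_pow (hK : Module.finrank F K = 3) {θ : K}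
    (hθ : IntermediateField.adjoin F {θ} = ⊤) (β : K) :
    ∃ u : Fin 3 → F, β = u 0 • 1 + u 1 • θ + u 2 • θ ^ 2 := by
  have : FiniteDimensional F K := Module.finite_of_finrank_pos (by omega)
  have hdeg : (minpoly F θ).natDegree = 3 := by
    rw [← IntermediateField.adjoin.finrank (Algebra.IsIntegral.isIntegral θ), hθ,
      IntermediateField.finrank_top', hK]
  have hli := linearIndependent_pow (K := F) θ
  rw [hdeg] at hli
  have hspan := hli.span_eq_top_of_card_eq_finrank (by rw [hK, Fintype.card_fin])
  have hβ : β ∈ Submodule.span F (Set.range fun i : Fin 3 ↦ θ ^ (i : ℕ)) := by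
    rw [hspan]
    trivial
  obtain ⟨u, hu⟩ := (Submodule.mem_span_range_iff_exists_fun F).1 hβ
  exact ⟨u, by simpa [Fin.sum_univ_three] using hu.symm⟩

omit [Fintype F] in
theorem span_rowForm (hK : Module.finrank F K = 3) {θ : K}
    (hθ : IntermediateField.adjoin F {θ} = ⊤) :
    Submodule.span F (Set.range (rowForm F θ)) = ⊤ := by
  refine eq_top_iff.2 fun f _ ↦ ?_
  obtain ⟨a, β, γ, d⟩ := f
  obtain ⟨u, rfl⟩ := exists_eq_smul_pow hK hθ β
  obtain ⟨v, rfl⟩ := exists_eq_smul_pow hK hθ γ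
  refine (Submodule.mem_span_range_iff_exists_fun F).2
    ⟨![a, u 0, u 1, u 2, v 0, v 1, v 2, d], ?_⟩
  simp [Fin.sum_univ_eight, rowForm]

theorem ovoidCode_eq_range (hK : Module.finrank F K = 3) {θ : K}
    (hθ : IntermediateField.adjoin F {θ} = ⊤) (x : Fin (Fintype.card F ^ 3) ≃ K) :
    ovoidCode F (Fintype.card F) θ x = LinearMap.range (codewordMap F x) := by
  have h : (fun i ↦ ovoidMatrix F (Fintype.card F) θ x i) = codewordMap F x ∘ rowForm F θ :=
    funext (ovoidMatrix_row θ x)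
  rw [ovoidCode, codeGeneratedBy, h, Set.range_comp, Submodule.span_image, span_rowForm hK hθ,
    Submodule.map_top]

variable [Fintype K] [DecidableEq F]

theorem hammingNorm_codewordMap {n : ℕ} (x : Fin n ≃ K) (f : F × K × K × F) :
    hammingNorm (codewordMap F x f) + (sectionPoints f).card = n + 1 := by
  have h : (sectionPoints f).card =
      (Finset.univ.filter fun j ↦ codewordMap F x f j = 0).card := by
    symm
    refine Finset.card_equiv (columnPoint x) fun j ↦ ?_
    rw [sectionPoints, Finset.mem_filter, Finset.mem_filter, codewordMap_apply]
    simp only [Finset.mem_univ, true_and]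
  rw [h, hammingNorm, add_comm, Finset.card_filter_add_card_filter_not, Finset.card_univ,
    Fintype.card_fin]

/-- A form vanishing on all of `O` is zero, as only one form has `q³ + 1` zeros. -/
theorem codewordMap_injective (hK : Module.finrank F K = 3) {n : ℕ} (x : Fin n ≃ K) :
    Function.Injective (codewordMap F x) := by
  classical
  refine (injective_iff_map_eq_zero _).2 fun f hf ↦ ?_
  have hcard : ∀ g, codewordMap F x g = 0 → (sectionPoints g).card = Fintype.card F ^ 3 + 1 := by
    intro g hg
    have := hammingNorm_codewordMap x g
    rw [hg, hammingNorm_zero, zero_add] at this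
    rw [this, ← card_eq_card_pow_three (F := F) hK, ← Fintype.card_congr x, Fintype.card_fin]
  obtain ⟨-, -, -, -, h, -⟩ := sectionCount_eq (F := F) (K := K) hK rfl rfl
  exact Finset.card_le_one.1 h.le f (by simpa using hcard f hf) 0
    (by simpa using hcard 0 (map_zero _))

theorem weightCount_ovoidCode (hK : Module.finrank F K = 3) {θ : K}
    (hθ : IntermediateField.adjoin F {θ} = ⊤) (x : Fin (Fintype.card F ^ 3) ≃ K) {i z : ℕ}
    (h : i + z = Fintype.card F ^ 3 + 1) :
    weightCount (ovoidCode F (Fintype.card F) θ x) i = sectionCount F K z := by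
  have hset : {c | c ∈ ovoidCode F (Fintype.card F) θ x ∧ hammingNorm c = i} = codewordMap F x ''
      (Finset.univ.filter fun f : F × K × K × F ↦ (sectionPoints f).card = z : Finset _) := by
    ext c
    rw [ovoidCode_eq_range hK hθ]
    simp only [Set.mem_ofPred_eq, LinearMap.mem_range, Set.mem_image, Finset.coe_filter,
      Finset.mem_univ, true_and]
    constructor
    · rintro ⟨⟨f, rfl⟩, hf⟩
      have := hammingNorm_codewordMap x f
      exact ⟨f, by omega, rfl⟩
    · rintro ⟨f, hf, rfl⟩
      have := hammingNorm_codewordMap x f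
      exact ⟨⟨f, rfl⟩, by omega⟩
  rw [weightCount, hset, Set.ncard_image_of_injective _ (codewordMap_injective hK x),
    Set.ncard_coe_finset, sectionCount]

omit [Fintype F] [Fintype K] in
theorem weightCount_eq_zero_of_lt {n : ℕ} (C : Submodule F (Fin n → F)) {i : ℕ} (h : n < i) :
    weightCount C i = 0 := by
  have : {c : Fin n → F | c ∈ C ∧ hammingNorm c = i} = ∅ := by
    refine Set.eq_empty_iff_forall_notMem.2 ?_
    rintro c ⟨-, hc⟩
    have := hammingNorm_le_card_fintype (x := c)
    rw [Fintype.card_fin] at this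
    omega
  rw [weightCount, this, Set.ncard_empty]

omit [Fintype K] in
theorem le_hammingNorm_of_weightCount_eq_zero {n : ℕ} (C : Submodule F (Fin n → F)) {d : ℕ}
    (h : ∀ i, i ≠ 0 → i < d → weightCount C i = 0) :
    ∀ c ∈ C, c ≠ 0 → d ≤ hammingNorm c := by
  intro c hc hc0
  by_contra hlt
  have := h _ (hammingNorm_ne_zero_iff.2 hc0) (not_le.1 hlt)
  rw [weightCount, Set.ncard_eq_zero (Set.toFinite _)] at this
  exact Set.eq_empty_iff_forall_notMem.1 this c ⟨hc, rfl⟩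

end Code

/-- The subtractions of natural numbers below do not truncate, since `q ≥ 2`. The multiplicities are
stated in `ℚ`. -/
theorem mainTheorem2 {F K : Type*} [Field F] [Fintype F] [DecidableEq F] [Field K] [Algebra F K]
    (q : ℕ) (hq : Fintype.card F = q) (hK : Module.finrank F K = 3)
    (θ : K) (hθ : IntermediateField.adjoin F {θ} = ⊤) (x : Fin (q ^ 3) ≃ K) :
    HasCodeParameters (ovoidCode F q θ x) 8 (q ^ 3 - q ^ 2 - q) ∧
    weightCount (ovoidCode F q θ x) 0 = 1 ∧
    (weightCount (ovoidCode F q θ x) (q * (q ^ 2 - q - 1)) : ℚ) =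
      1 / 2 * (q : ℚ) ^ 3 * ((q : ℚ) ^ 3 + 1) * ((q : ℚ) - 1) ^ 2 ∧
    (weightCount (ovoidCode F q θ x) (q ^ 2 * (q - 1)) : ℚ) =
      (q : ℚ) * ((q : ℚ) ^ 6 - 1) ∧
    (weightCount (ovoidCode F q θ x) (q * (q ^ 2 - q + 1)) : ℚ) =
      1 / 2 * (q : ℚ) ^ 3 * ((q : ℚ) ^ 3 - 1) * ((q : ℚ) ^ 2 - 1) ∧
    (weightCount (ovoidCode F q θ x) (q ^ 3) : ℚ) =
      ((q : ℚ) ^ 3 + 1) * ((q : ℚ) - 1) ∧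
    ∀ i : ℕ, i ≠ 0 → i ≠ q * (q ^ 2 - q - 1) → i ≠ q ^ 2 * (q - 1) →
      i ≠ q * (q ^ 2 - q + 1) → i ≠ q ^ 3 → weightCount (ovoidCode F q θ x) i = 0 := by
  subst hq
  have : Fintype K := Fintype.ofEquiv _ x
  classical
  obtain ⟨s2, s1, s0, sone, sall, snone⟩ := sectionCount_eq (F := F) (K := K) hK rfl rfl
  have hn2 : 2 ≤ Fintype.card F := Fintype.one_lt_card
  have hW := fun {i z : ℕ} ↦ weightCount_ovoidCode hK hθ x (i := i) (z := z)
  -- The four weights as polynomials in `k`, where `q = k + 2`.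
  obtain ⟨k, hk⟩ : ∃ k, Fintype.card F = k + 2 := ⟨Fintype.card F - 2, by omega⟩
  have e2 : Fintype.card F ^ 2 = k ^ 2 + 4 * k + 4 := by rw [hk]; ring
  have e3 : Fintype.card F ^ 3 = k ^ 3 + 6 * k ^ 2 + 12 * k + 8 := by rw [hk]; ring
  have w2 : Fintype.card F * (Fintype.card F ^ 2 - Fintype.card F - 1) =
      k ^ 3 + 5 * k ^ 2 + 7 * k + 2 := by
    rw [e2, hk, show k ^ 2 + 4 * k + 4 - (k + 2) - 1 = k ^ 2 + 3 * k + 1 by omega]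
    ring
  have w1 : Fintype.card F ^ 2 * (Fintype.card F - 1) = k ^ 3 + 5 * k ^ 2 + 8 * k + 4 := by
    rw [e2, hk, show k + 2 - 1 = k + 1 by omega]
    ring
  have w0 : Fintype.card F * (Fintype.card F ^ 2 - Fintype.card F + 1) =
      k ^ 3 + 5 * k ^ 2 + 9 * k + 6 := by
    rw [e2, hk, show k ^ 2 + 4 * k + 4 - (k + 2) + 1 = k ^ 2 + 3 * k + 3 by omega]
    ring
  have hnone : ∀ i : ℕ, i ≠ 0 →
      i ≠ Fintype.card F * (Fintype.card F ^ 2 - Fintype.card F - 1) →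
      i ≠ Fintype.card F ^ 2 * (Fintype.card F - 1) →
      i ≠ Fintype.card F * (Fintype.card F ^ 2 - Fintype.card F + 1) →
      i ≠ Fintype.card F ^ 3 → weightCount (ovoidCode F (Fintype.card F) θ x) i = 0 := by
    intro i i0 i1 i2 i3 i4
    rcases le_or_gt i (Fintype.card F ^ 3 + 1) with hi | hi
    · rw [hW (Nat.add_sub_cancel' hi)]
      exact snone _ (by omega) (by omega) (by omega) (by omega) (by omega)
    · exact weightCount_eq_zero_of_lt _ hi
  refine ⟨⟨?_, ?_⟩, ?_, ?_, ?_, ?_, ?_, hnone⟩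
  · rw [ovoidCode_eq_range hK hθ, LinearMap.finrank_range_of_inj (codewordMap_injective hK x),
      finrank_forms hK]
  · refine le_hammingNorm_of_weightCount_eq_zero _ fun i i0 hi ↦ ?_
    exact hnone i i0 (by omega) (by omega) (by omega) (by omega)
  · rw [hW (zero_add _), sall]
  · rw [hW (z := Fintype.card F ^ 2 + Fintype.card F + 1) (by omega), s2]
  · rw [hW (z := Fintype.card F ^ 2 + 1) (by omega), s1]
  · rw [hW (z := Fintype.card F ^ 2 - Fintype.card F + 1) (by omega), s0]
  · rw [hW rfl, sone]
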